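/- Let $x,t$ be real coordinates and let $\beta=\beta(t,x)$ be an arbitrary smooth real function on an open set $\Omega\subseteq\mathbb R^2$ with $\partial\beta/\partial x\ne 0$ at every point of $\Omega$. Consider the evolution equation $$u_t = F := \beta_x u^2 u_{xx} + 2\beta_{xx}u^2u_x + 4\beta u_x + (\beta_{xxx}-4\beta_x)u^3 - 4\beta_x u ,$$ and the matrices $$A=\begin{pmatrix} \frac1u & 1\\ 1& -\frac1u\end{pmatrix},\qquad B=\begin{pmatrix} -\beta_x u_x+\frac{4\beta}{u}-\beta_{xx}u & 4\beta+2\beta_x u\\ 4\beta-2\beta_x u & \beta_x u_x-\frac{4\beta}{u}+\beta_{xx}u\end{pmatrix}.$$ Let $E=\mathbb R^\infty$ be the space with coordinates $t,x,u=u_0,u_1=u_x,u_2=u_{xx},\dots$, with the product topology, whose smooth functions are those depending smoothly, locally, on finitely many coordinates, and let $$D_x=\partial_x+\sum_{k\ge0}u_{k+1}\,\partial_{u_k},\qquad D_t=\partial_t+\sum_{k\ge0}(D_x^kF)\,\partial_{u_k}.$$ Let $\mathbb K$ be $\mathbb R$ or $\mathbb C$. For a Lie algebra $\mathfrak g\subseteq\mathfrak{sl}_2(\mathbb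 K)$, a $\mathfrak g$-valued zero-curvature representation (ZCR) on an open set $U\subseteq E$ is a form $\alpha=A'\,dx+B'\,dt$ with smooth $\mathfrak g$-valued $A',B'$ on $U$ such that $D_tA'-D_xB'+[A',B']=0$ on $U$. Two forms are gauge equivalent on $U$ if one is obtained from the other as $\alpha\mapsto dS\,S^{-1}+S\alpha S^{-1}$, $dS=D_xS\,dx+D_tS\,dt$, for a smooth function $S:U\to SL_2(\mathbb K)$. An $\mathfrak{sl}_2$-valued ZCR on $U$ is reducible on $U$ if it is gauge equivalent on $U$ to a ZCR with values in a proper Lie subalgebra of $\mathfrak{sl}_2(\mathbb K)$, and irreducible otherwise. Then, on every non-empty open set $U\subseteq E$ contained in the region $\{(t,x)\in\Omega,\ u\neq0\}$ (in particular on the whole region, if $\Omega\ne\emptyset$), $A\,dx+B\,dt$ is an irreducible $\mathfrak{sl}_2(\mathbb K)$-valued ZCR of the equation. In particular, it is not gauge equivalent on $U$ to any form $A'\,dx+B'\,dt$ in which $A'$ and $B'$ are lower triangular, whatever the diagonal entries. -/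

import Mathlib

open scoped ContDiff MatrixGroups

noncomputable section

namespace ZeroCurvature

/-- The infinite-dimensional space with coordinates `t`, `x` and `u_k` for `k = 0, 1, 2, …`
(`u_0 = u`, `u_1 = u_x`, `u_2 = u_xx`, …), with the product topology. It is the equation manifold
of any scalar evolution equation. -/
abbrev Jet : Type := ℝ × ℝ × (ℕ → ℝ)

namespace Jet

/-- The coordinate `t`. -/
def t (θ : Jet) : ℝ := θ.1

/-- The coordinate `x`. -/
def x (θ : Jet) : ℝ := θ.2.1

/-- The coordinate `u_k`. -/
def u (θ : Jet) (k : ℕ) : ℝ := θ.2.2 k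

/-- Projection onto the coordinates `t, x, u_0, …, u_{n-1}`. -/
def trunc (n : ℕ) (θ : Jet) : ℝ × ℝ × (Fin n → ℝ) := (θ.t, θ.x, fun i => θ.u i)

end Jet

section Functions

variable {V : Type*} [NormedAddCommGroup V] [NormedSpace ℝ V]

/-- Smooth functions on jet space: near every point of `U`, the function is a smooth function
of finitely many of the coordinates. -/
def SmoothOn (f : Jet → V) (U : Set Jet) : Prop :=
  ∀ θ ∈ U, ∃ (n : ℕ) (W : Set (ℝ × ℝ × (Fin n → ℝ))) (g : ℝ × ℝ × (Fin n → ℝ) → V),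
    IsOpen W ∧ θ.trunc n ∈ W ∧ ContDiffOn ℝ ∞ g W ∧
      ∀ η : Jet, η.trunc n ∈ W → f η = g (η.trunc n)

/-- `∂f/∂t`. -/
def partialT (f : Jet → V) (θ : Jet) : V := deriv (fun s : ℝ => f (s, θ.x, θ.u)) θ.t

/-- `∂f/∂x`. -/
def partialX (f : Jet → V) (θ : Jet) : V := deriv (fun s : ℝ => f (θ.t, s, θ.u)) θ.x

/-- `∂f/∂u_k`. -/
def partialU (k : ℕ) (f : Jet → V) (θ : Jet) : V :=
  deriv (fun s : ℝ => f (θ.t, θ.x, Function.update θ.u k s)) (θ.u k)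

/-- The total derivative `D_x = ∂/∂x + ∑_k u_{k+1} ∂/∂u_k`. The sum is finite on smooth functions,
since these depend locally on finitely many coordinates. -/
def totalX (f : Jet → V) (θ : Jet) : V :=
  partialX f θ + ∑ᶠ k : ℕ, θ.u (k + 1) • partialU k f θ

/-- The total derivative `D_t = ∂/∂t + ∑_k (D_x^k F) ∂/∂u_k` along the evolution equation
`u_t = F`. -/
def totalT (F : Jet → ℝ) (f : Jet → V) (θ : Jet) : V :=
  partialT f θ + ∑ᶠ k : ℕ, (totalX^[k] F) θ • partialU k f θ

end Functions

section Representations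

variable {𝕜 : Type*} [RCLike 𝕜]

attribute [local instance] LieRing.ofAssociativeRing

/-- Entrywise smoothness of a matrix-valued function. -/
def MatrixSmoothOn (M : Jet → Matrix (Fin 2) (Fin 2) 𝕜) (U : Set Jet) : Prop :=
  ∀ i j, SmoothOn (fun θ => M θ i j) U

/-- `D_x` acting entrywise on matrix-valued functions. -/
def matrixTotalX (M : Jet → Matrix (Fin 2) (Fin 2) 𝕜) (θ : Jet) : Matrix (Fin 2) (Fin 2) 𝕜 :=
  Matrix.of fun i j => totalX (fun η => M η i j) θ

/-- `D_t` acting entrywise on matrix-valued functions. -/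
def matrixTotalT (F : Jet → ℝ) (M : Jet → Matrix (Fin 2) (Fin 2) 𝕜) (θ : Jet) :
    Matrix (Fin 2) (Fin 2) 𝕜 :=
  Matrix.of fun i j => totalT F (fun η => M η i j) θ

/-- `A dx + B dt` is a `𝔤`-valued zero-curvature representation, on the subset `U` of jet space,
of the evolution equation `u_t = F`. -/
structure IsZCROn (𝔤 : LieSubalgebra 𝕜 (Matrix (Fin 2) (Fin 2) 𝕜)) (F : Jet → ℝ) (U : Set Jet)
    (A B : Jet → Matrix (Fin 2) (Fin 2) 𝕜) : Prop where
  smooth_A : MatrixSmoothOn A U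
  smooth_B : MatrixSmoothOn B U
  mem_A : ∀ θ ∈ U, A θ ∈ 𝔤
  mem_B : ∀ θ ∈ U, B θ ∈ 𝔤
  zero_curvature : ∀ θ ∈ U,
    matrixTotalT F A θ - matrixTotalX B θ + (A θ * B θ - B θ * A θ) = 0

/-- `A' dx + B' dt` is obtained from `α = A dx + B dt`, over `U`, by a gauge transformation
`α ↦ dS S⁻¹ + S α S⁻¹` with a smooth `SL₂`-valued function `S`; here `dS = D_x S dx + D_t S dt`. -/
def GaugeEquivOn (F : Jet → ℝ) (U : Set Jet) (A B A' B' : Jet → Matrix (Fin 2) (Fin 2) 𝕜) : Prop :=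
  ∃ S : Jet → SL(2, 𝕜),
    MatrixSmoothOn (fun θ => (S θ : Matrix (Fin 2) (Fin 2) 𝕜)) U ∧
    ∀ θ ∈ U,
      A' θ = matrixTotalX (fun η => (S η : Matrix (Fin 2) (Fin 2) 𝕜)) θ * (((S θ)⁻¹ : SL(2, 𝕜)) :
          Matrix (Fin 2) (Fin 2) 𝕜) +
        (S θ : Matrix (Fin 2) (Fin 2) 𝕜) * A θ * (((S θ)⁻¹ : SL(2, 𝕜)) :
          Matrix (Fin 2) (Fin 2) 𝕜) ∧
      B' θ = matrixTotalT F (fun η => (S η : Matrix (Fin 2) (Fin 2) 𝕜)) θ *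
          (((S θ)⁻¹ : SL(2, 𝕜)) : Matrix (Fin 2) (Fin 2) 𝕜) +
        (S θ : Matrix (Fin 2) (Fin 2) 𝕜) * B θ * (((S θ)⁻¹ : SL(2, 𝕜)) :
          Matrix (Fin 2) (Fin 2) 𝕜)

/-- The Lie algebra `sl₂` of traceless matrices. -/
abbrev sl₂ (𝕜 : Type*) [RCLike 𝕜] : LieSubalgebra 𝕜 (Matrix (Fin 2) (Fin 2) 𝕜) :=
  LieAlgebra.SpecialLinear.sl (Fin 2) 𝕜

/-- The `sl₂`-valued form `A dx + B dt` is reducible over `U`: it is gauge equivalent to a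
zero-curvature representation with values in a proper subalgebra of `sl₂`. -/
def ReducibleOn (F : Jet → ℝ) (U : Set Jet) (A B : Jet → Matrix (Fin 2) (Fin 2) 𝕜) : Prop :=
  ∃ 𝔥 : LieSubalgebra 𝕜 (Matrix (Fin 2) (Fin 2) 𝕜), 𝔥 < sl₂ 𝕜 ∧
    ∃ A' B' : Jet → Matrix (Fin 2) (Fin 2) 𝕜,
      IsZCROn 𝔥 F U A' B' ∧ GaugeEquivOn F U A B A' B'

/-- `A dx + B dt` is an irreducible `sl₂`-valued zero-curvature representation over `U`. -/
def IrreducibleZCROn (F : Jet → ℝ) (U : Set Jet) (A B : Jet → Matrix (Fin 2) (Fin 2) 𝕜) : Prop :=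
  IsZCROn (sl₂ 𝕜) F U A B ∧ ¬ ReducibleOn F U A B

/-- The upper right entries of `A` and `B` vanish over `U`. -/
def LowerTriangularOn (U : Set Jet) (A B : Jet → Matrix (Fin 2) (Fin 2) 𝕜) : Prop :=
  ∀ θ ∈ U, A θ 0 1 = 0 ∧ B θ 0 1 = 0

end Representations

section TheClass

/-- The `k`-th derivative `∂^k β/∂x^k` as a function on jet space; `β` takes the arguments
`t, x`. -/
def derivX (k : ℕ) (β : ℝ → ℝ → ℝ) (θ : Jet) : ℝ := iteratedDeriv k (β θ.t) θ.x

/-- The right-hand side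
`β_x u² u_xx + 2 β_xx u² u_x + 4 β u_x + (β_xxx - 4 β_x) u³ - 4 β_x u`. -/
def evolutionRHS (β : ℝ → ℝ → ℝ) (θ : Jet) : ℝ :=
  derivX 1 β θ * θ.u 0 ^ 2 * θ.u 2 + 2 * derivX 2 β θ * θ.u 0 ^ 2 * θ.u 1
    + 4 * β θ.t θ.x * θ.u 1 + (derivX 3 β θ - 4 * derivX 1 β θ) * θ.u 0 ^ 3
    - 4 * derivX 1 β θ * θ.u 0

/-- The matrix `A` of the representation. -/
def matrixA (𝕜 : Type*) [RCLike 𝕜] (θ : Jet) : Matrix (Fin 2) (Fin 2) 𝕜 :=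
  Matrix.map !![1 / θ.u 0, 1; 1, -(1 / θ.u 0)] (fun r : ℝ => (r : 𝕜))

/-- The diagonal entry `-β_x u_x + 4 β / u - β_xx u` of `B`. -/
def entryB (β : ℝ → ℝ → ℝ) (θ : Jet) : ℝ :=
  -derivX 1 β θ * θ.u 1 + 4 * (β θ.t θ.x / θ.u 0) - derivX 2 β θ * θ.u 0

/-- The matrix `B` of the representation. -/
def matrixB (𝕜 : Type*) [RCLike 𝕜] (β : ℝ → ℝ → ℝ) (θ : Jet) : Matrix (Fin 2) (Fin 2) 𝕜 :=
  Matrix.map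
    !![entryB β θ, 4 * β θ.t θ.x + 2 * derivX 1 β θ * θ.u 0;
       4 * β θ.t θ.x - 2 * derivX 1 β θ * θ.u 0, -entryB β θ] (fun r : ℝ => (r : 𝕜))

/-- The part of jet space over `Ω` on which `u ≠ 0`. -/
def regularRegion (Ω : Set (ℝ × ℝ)) : Set Jet := {θ | (θ.t, θ.x) ∈ Ω ∧ θ.u 0 ≠ 0}

end TheClass

end ZeroCurvature

end

/-!
The property that matters is that the `u`-derivative of `A` is a non-zero multiple of
`h = diag(1, -1)`. A proper subalgebra of `sl₂` normalises some line `𝕜 N`; if the transformed form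
takes its values there, then `Q = S⁻¹ N S` satisfies `D_x Q = [A, Q] + a Q` with an unknown scalar
function `a`. Normalising `Q` by a linear functional eliminates `a` and leaves an equation
`D_x ρ = G(u, ρ)`. A function of finitely many jet coordinates satisfying such an equation depends
on no `u_k`: the top-order terms of `D_x ρ` cannot be matched on the right. Hence `∂G/∂u = 0` along
`ρ`, which says that `Q` is an eigenvector of `ad h`. The entries of `Q` then have pairwise
vanishing products, and applying `D_x` to these products gives `Q = 0`, so `N = 0`.
-/

noncomputable section

namespace ZeroCurvature

section Calculus

variable {V V' : Type*} [NormedAddCommGroup V] [NormedSpace ℝ V]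
  [NormedAddCommGroup V'] [NormedSpace ℝ V']

namespace Jet

/-- The vector `∂/∂u_k` on jet space. -/
def uDir (k : ℕ) : Jet := (0, 0, Pi.single k 1)

/-- The shift `(t, x, u_0, u_1, …) ↦ (0, 0, u_1, u_2, …)`, which is the linear part of the vector
field `D_x`. -/
def shift (v : Jet) : Jet := (0, 0, fun k => v.u (k + 1))

/-- The value at `θ` of the total derivative `D_x`, as a vector on jet space. -/
def totalXDir (θ : Jet) : Jet := (0, 1, fun k => θ.u (k + 1))

/-- The value at `θ` of the total derivative `D_t`, as a vector on jet space. -/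
def totalTDir (F : Jet → ℝ) (θ : Jet) : Jet := (1, 0, fun k => (totalX^[k] F) θ)

theorem continuous_trunc (n : ℕ) : Continuous (trunc n) := by
  unfold trunc t x u
  fun_prop

theorem shift_uDir_zero : shift (uDir 0) = 0 :=
  Prod.ext rfl <| Prod.ext rfl <| funext fun k => by simp [shift, uDir, u]

theorem shift_uDir_succ (k : ℕ) : shift (uDir (k + 1)) = uDir k :=
  Prod.ext rfl <| Prod.ext rfl <| funext fun i => by simp [shift, uDir, u, Pi.single_apply]

theorem trunc_uDir_of_le {n k : ℕ} (h : n ≤ k) : (uDir k).trunc n = 0 :=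
  Prod.ext rfl <| Prod.ext rfl <| funext fun i => by
    simp [trunc, uDir, u, Pi.single_apply, (i.isLt.trans_le h).ne]

theorem trunc_eq_sum (n : ℕ) (v : Jet) :
    v.trunc n = v.t • (1, 0, 0) + v.x • (0, 1, 0) + ∑ k : Fin n, v.u k • (uDir k).trunc n := by
  refine Prod.ext ?_ (Prod.ext ?_ (funext fun i => ?_))
  · simp [trunc, uDir, t, Prod.fst_sum]
  · simp [trunc, uDir, t, x, Prod.fst_sum, Prod.snd_sum]
  · simp [trunc, uDir, u, Prod.snd_sum, Finset.sum_apply, Pi.single_apply, Fin.val_inj]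

end Jet

open Jet

theorem partialT_eq_lineDeriv (f : Jet → V) (θ : Jet) :
    partialT f θ = lineDeriv ℝ f θ (1, 0, 0) := by
  have hline (s : ℝ) : (θ.t + s, θ.x, θ.u) = θ + s • (1, 0, 0) :=
    Prod.ext (by simp [t]) (Prod.ext (by simp [x]) (funext fun i => by simp [u]))
  have h := deriv_comp_const_add (f := fun s : ℝ => f (s, θ.x, θ.u)) (a := θ.t) (x := 0)
  simpa only [partialT, lineDeriv, hline, add_zero] using h.symm

theorem partialX_eq_lineDeriv (f : Jet → V) (θ : Jet) :
    partialX f θ = lineDeriv ℝ f θ (0, 1, 0) := by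
  have hline (s : ℝ) : (θ.t, θ.x + s, θ.u) = θ + s • (0, 1, 0) :=
    Prod.ext (by simp [t]) (Prod.ext (by simp [x]) (funext fun i => by simp [u]))
  have h := deriv_comp_const_add (f := fun s : ℝ => f (θ.t, s, θ.u)) (a := θ.x) (x := 0)
  simpa only [partialX, lineDeriv, hline, add_zero] using h.symm

theorem partialU_eq_lineDeriv (k : ℕ) (f : Jet → V) (θ : Jet) :
    partialU k f θ = lineDeriv ℝ f θ (uDir k) := by
  have hline (s : ℝ) : (θ.t, θ.x, Function.update θ.u k (θ.u k + s)) = θ + s • uDir k := by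
    refine Prod.ext (by simp [t, uDir]) (Prod.ext (by simp [x, uDir]) (funext fun i => ?_))
    obtain rfl | hik := eq_or_ne i k
    · simp [u, uDir]
    · simp [u, uDir, hik]
  have h := deriv_comp_const_add
    (f := fun s : ℝ => f (θ.t, θ.x, Function.update θ.u k s)) (a := θ.u k) (x := 0)
  simpa only [partialU, lineDeriv, hline, add_zero] using h.symm

theorem lineDeriv_eq_of_eqOn {f g : Jet → V} {U : Set Jet} (hU : IsOpen U) (h : Set.EqOn f g U)
    {θ : Jet} (hθ : θ ∈ U) (v : Jet) : lineDeriv ℝ f θ v = lineDeriv ℝ g θ v := by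
  have hline : ContinuousAt (fun s : ℝ => θ + s • v) 0 := by fun_prop
  refine Filter.EventuallyEq.deriv_eq ?_
  filter_upwards [hline.preimage_mem_nhds (hU.mem_nhds (by simpa using hθ))] with s hs
  exact h hs

theorem hasLineDerivAt_u (k : ℕ) (θ v : Jet) :
    HasLineDerivAt ℝ (fun η : Jet => η.u k) (v.u k) θ v :=
  (((hasDerivAt_id (0 : ℝ)).mul_const (v.u k)).const_add (θ.u k)).congr_deriv (one_mul _)

/-- `f` is given, at the jets whose truncation lies in the open set `W`, by the smooth function `g`
of the coordinates `t, x, u_0, …, u_{n-1}`. -/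
structure Represents {n : ℕ} (f : Jet → V) (W : Set (ℝ × ℝ × (Fin n → ℝ)))
    (g : ℝ × ℝ × (Fin n → ℝ) → V) : Prop where
  isOpen : IsOpen W
  contDiffOn : ContDiffOn ℝ ∞ g W
  eq : ∀ η : Jet, η.trunc n ∈ W → f η = g (η.trunc n)

namespace Represents

variable {n : ℕ} {f : Jet → V} {W : Set (ℝ × ℝ × (Fin n → ℝ))} {g : ℝ × ℝ × (Fin n → ℝ) → V}

theorem smoothOn (h : Represents f W g) {U : Set Jet} (hU : ∀ θ ∈ U, θ.trunc n ∈ W) :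
    SmoothOn f U :=
  fun θ hθ => ⟨n, W, g, h.isOpen, hU θ hθ, h.contDiffOn, h.eq⟩

theorem isOpen_preimage (h : Represents f W g) : IsOpen (trunc n ⁻¹' W) :=
  h.isOpen.preimage (continuous_trunc n)

theorem differentiableAt (h : Represents f W g) {y : ℝ × ℝ × (Fin n → ℝ)} (hy : y ∈ W) :
    DifferentiableAt ℝ g y :=
  (h.contDiffOn.contDiffAt (h.isOpen.mem_nhds hy)).differentiableAt (by simp)

theorem hasLineDerivAt (h : Represents f W g) {θ : Jet} (hθ : θ.trunc n ∈ W) (v : Jet) :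
    HasLineDerivAt ℝ f (fderiv ℝ g (θ.trunc n) (v.trunc n)) θ v := by
  have hline : ContinuousAt (fun s : ℝ => θ + s • v) 0 := by fun_prop
  refine HasDerivAt.congr_of_eventuallyEq
    ((h.differentiableAt hθ).hasFDerivAt.hasLineDerivAt (v.trunc n)) ?_
  filter_upwards [hline.preimage_mem_nhds (h.isOpen_preimage.mem_nhds (by simpa using hθ))]
    with s hs
  exact h.eq _ hs

theorem lineDeriv_eq (h : Represents f W g) {θ : Jet} (hθ : θ.trunc n ∈ W) (v : Jet) :
    lineDeriv ℝ f θ v = fderiv ℝ g (θ.trunc n) (v.trunc n) :=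
  (h.hasLineDerivAt hθ v).lineDeriv

theorem partialU_of_le (h : Represents f W g) {θ : Jet} (hθ : θ.trunc n ∈ W) {k : ℕ}
    (hk : n ≤ k) : partialU k f θ = 0 := by
  rw [partialU_eq_lineDeriv, h.lineDeriv_eq hθ, trunc_uDir_of_le hk, map_zero]

theorem lineDeriv_const (h : Represents f W g) (v : Jet) :
    Represents (fun η => lineDeriv ℝ f η v) W fun y => fderiv ℝ g y (v.trunc n) where
  isOpen := h.isOpen
  contDiffOn := (h.contDiffOn.fderiv_of_isOpen h.isOpen (by simp)).clm_apply contDiffOn_const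
  eq _ hη := h.lineDeriv_eq hη v

theorem comp (h : Represents f W g) {G : V → V'} {s : Set V} (hs : IsOpen s)
    (hG : ContDiffOn ℝ ∞ G s) : Represents (fun η => G (f η)) (W ∩ g ⁻¹' s) (G ∘ g) where
  isOpen := h.contDiffOn.continuousOn.isOpen_inter_preimage h.isOpen hs
  contDiffOn := hG.comp (h.contDiffOn.mono Set.inter_subset_left) fun _ hy => hy.2
  eq η hη := congrArg G (h.eq η hη.1)

theorem comp_castLE (h : Represents f W g) {m : ℕ} (hnm : n ≤ m) :
    Represents f {y : ℝ × ℝ × (Fin m → ℝ) | (y.1, y.2.1, y.2.2 ∘ Fin.castLE hnm) ∈ W}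
      fun y => g (y.1, y.2.1, y.2.2 ∘ Fin.castLE hnm) := by
  have hres : ContDiff ℝ ∞ fun y : ℝ × ℝ × (Fin m → ℝ) =>
      (y.1, y.2.1, y.2.2 ∘ Fin.castLE hnm) := by
    unfold Function.comp
    fun_prop
  exact ⟨h.isOpen.preimage hres.continuous, h.contDiffOn.comp hres.contDiffOn fun _ hy => hy,
    fun η hη => h.eq η hη⟩

theorem pi {ι : Type*} [Fintype ι] {E : ι → Type*} [∀ i, NormedAddCommGroup (E i)]
    [∀ i, NormedSpace ℝ (E i)] {f : Jet → ∀ i, E i} {W : ι → Set (ℝ × ℝ × (Fin n → ℝ))}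
    {g : ∀ i, ℝ × ℝ × (Fin n → ℝ) → E i}
    (h : ∀ i, Represents (fun η => f η i) (W i) (g i)) :
    Represents f (⋂ i, W i) fun y i => g i y where
  isOpen := isOpen_iInter_of_finite fun i => (h i).isOpen
  contDiffOn := contDiffOn_pi.2 fun i => (h i).contDiffOn.mono (Set.iInter_subset W i)
  eq η hη := funext fun i => (h i).eq η (Set.mem_iInter.1 hη i)

theorem prodMk (h : Represents f W g) {f' : Jet → V'} {W' : Set (ℝ × ℝ × (Fin n → ℝ))}
    {g' : ℝ × ℝ × (Fin n → ℝ) → V'} (h' : Represents f' W' g') :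
    Represents (fun η => (f η, f' η)) (W ∩ W') fun y => (g y, g' y) where
  isOpen := h.isOpen.inter h'.isOpen
  contDiffOn := (h.contDiffOn.mono Set.inter_subset_left).prodMk
    (h'.contDiffOn.mono Set.inter_subset_right)
  eq η hη := Prod.ext (h.eq η hη.1) (h'.eq η hη.2)

theorem lineDeriv_eq_partials (h : Represents f W g) {θ : Jet} (hθ : θ.trunc n ∈ W) (v : Jet) :
    lineDeriv ℝ f θ v =
      v.t • partialT f θ + v.x • partialX f θ + ∑ᶠ k, v.u k • partialU k f θ := by
  have hsupp : (Function.support fun k => v.u k • partialU k f θ) ⊆ Finset.range n := fun k hk => by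
    by_contra hkn
    exact hk (by simp [h.partialU_of_le hθ (by simpa using hkn)])
  rw [finsum_eq_sum_of_support_subset _ hsupp, Finset.sum_range, h.lineDeriv_eq hθ,
    trunc_eq_sum n v]
  simp only [map_add, map_sum, map_smul, partialT_eq_lineDeriv, partialX_eq_lineDeriv,
    partialU_eq_lineDeriv, h.lineDeriv_eq hθ]
  rfl

theorem totalX_eq (h : Represents f W g) {θ : Jet} (hθ : θ.trunc n ∈ W) :
    totalX f θ = fderiv ℝ g (θ.trunc n) (θ.totalXDir.trunc n) := by
  rw [← h.lineDeriv_eq hθ, h.lineDeriv_eq_partials hθ]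
  simp [totalX, totalXDir, t, x, u]

theorem totalT_eq (h : Represents f W g) (F : Jet → ℝ) {θ : Jet} (hθ : θ.trunc n ∈ W) :
    totalT F f θ = fderiv ℝ g (θ.trunc n) ((totalTDir F θ).trunc n) := by
  rw [← h.lineDeriv_eq hθ, h.lineDeriv_eq_partials hθ]
  simp [totalT, totalTDir, t, x, u]

/-- Here `shift v` is the derivative in the direction `v` of the coefficients of the vector field
`D_x`; the other terms cancel by the symmetry of second derivatives. -/
theorem lineDeriv_totalX (h : Represents f W g) {θ : Jet} (hθ : θ.trunc n ∈ W) (v : Jet) :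
    lineDeriv ℝ (totalX f) θ v =
      totalX (fun η => lineDeriv ℝ f η v) θ + lineDeriv ℝ f θ (shift v) := by
  have hcd := h.contDiffOn.contDiffAt (h.isOpen.mem_nhds hθ)
  have hg' : DifferentiableAt ℝ (fderiv ℝ g) (θ.trunc n) :=
    (hcd.fderiv_right (m := 1) (WithTop.coe_le_coe.2 le_top)).differentiableAt (by simp)
  have hsymm : IsSymmSndFDerivAt ℝ g (θ.trunc n) :=
    hcd.isSymmSndFDerivAt (by
      rw [minSmoothness_of_isRCLikeNormedField]
      exact WithTop.coe_le_coe.2 le_top)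
  have hdir : HasDerivAt (fun s : ℝ => (θ + s • v).totalXDir.trunc n) ((shift v).trunc n) 0 := by
    have hlin (s : ℝ) : (θ + s • v).totalXDir.trunc n =
        θ.totalXDir.trunc n + s • (shift v).trunc n :=
      Prod.ext (by simp [trunc, totalXDir, shift, t])
        (Prod.ext (by simp [trunc, totalXDir, shift, t, x]) rfl)
    simp only [hlin]
    exact (((hasDerivAt_id (0 : ℝ)).smul_const _).const_add _).congr_deriv (one_smul _ _)
  have hfderiv : HasDerivAt (fun s : ℝ => fderiv ℝ g ((θ + s • v).trunc n))
      (fderiv ℝ (fderiv ℝ g) (θ.trunc n) (v.trunc n)) 0 :=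
    hg'.hasFDerivAt.hasLineDerivAt (v.trunc n)
  have happly : HasLineDerivAt ℝ
      (fun η : Jet => fderiv ℝ g (η.trunc n) (η.totalXDir.trunc n))
      (fderiv ℝ (fderiv ℝ g) (θ.trunc n) (v.trunc n) (θ.totalXDir.trunc n) +
        fderiv ℝ g (θ.trunc n) ((shift v).trunc n)) θ v := by
    have := hfderiv.clm_apply hdir
    simp only [zero_smul, add_zero] at this
    exact this
  rw [lineDeriv_eq_of_eqOn h.isOpen_preimage (fun η hη => h.totalX_eq hη) hθ, happly.lineDeriv,
    (h.lineDeriv_const v).totalX_eq hθ, h.lineDeriv_eq hθ, hsymm,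
    fderiv_clm_apply hg' (differentiableAt_const _)]
  simp

end Represents

namespace SmoothOn

variable {f : Jet → V} {U : Set Jet}

theorem exists_represents (hf : SmoothOn f U) {θ : Jet} (hθ : θ ∈ U) :
    ∃ (n : ℕ) (W : Set (ℝ × ℝ × (Fin n → ℝ))) (g : ℝ × ℝ × (Fin n → ℝ) → V),
      θ.trunc n ∈ W ∧ Represents f W g := by
  obtain ⟨n, W, g, hW, hθW, hg, hfg⟩ := hf θ hθ
  exact ⟨n, W, g, hθW, hW, hg, hfg⟩

theorem eventually_exists_represents (hf : SmoothOn f U) {θ : Jet} (hθ : θ ∈ U) :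
    ∀ᶠ m : ℕ in Filter.atTop, ∃ (W : Set (ℝ × ℝ × (Fin m → ℝ))) (g : ℝ × ℝ × (Fin m → ℝ) → V),
      θ.trunc m ∈ W ∧ Represents f W g := by
  obtain ⟨n, W, g, hθW, h⟩ := hf.exists_represents hθ
  filter_upwards [Filter.eventually_ge_atTop n] with m hnm
  exact ⟨_, _, hθW, h.comp_castLE hnm⟩

theorem mono (hf : SmoothOn f U) {U' : Set Jet} (h : U' ⊆ U) : SmoothOn f U' :=
  fun θ hθ => hf θ (h hθ)

theorem comp (hf : SmoothOn f U) {G : V → V'} {s : Set V} (hs : IsOpen s)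
    (hG : ContDiffOn ℝ ∞ G s) (hfs : ∀ θ ∈ U, f θ ∈ s) : SmoothOn (fun η => G (f η)) U := by
  intro θ hθ
  obtain ⟨n, W, g, hθW, h⟩ := hf.exists_represents hθ
  exact (h.comp hs hG).smoothOn (U := {θ}) (by
    rintro _ rfl
    exact ⟨hθW, by simpa [h.eq _ hθW] using hfs _ hθ⟩) θ rfl

theorem clm_apply (hf : SmoothOn f U) (L : V →L[ℝ] V') : SmoothOn (fun η => L (f η)) U :=
  hf.comp isOpen_univ L.contDiff.contDiffOn fun _ _ => trivial

theorem pi {ι : Type*} [Fintype ι] {E : ι → Type*} [∀ i, NormedAddCommGroup (E i)]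
    [∀ i, NormedSpace ℝ (E i)] {f : Jet → ∀ i, E i} (hf : ∀ i, SmoothOn (fun η => f η i) U) :
    SmoothOn f U := by
  intro θ hθ
  obtain ⟨n, hn⟩ :=
    (Filter.eventually_all.2 fun i => (hf i).eventually_exists_represents hθ).exists
  choose W g hθW h using hn
  exact (Represents.pi h).smoothOn (U := {θ}) (by
    rintro _ rfl
    exact Set.mem_iInter.2 hθW) θ rfl

theorem prodMk (hf : SmoothOn f U) {f' : Jet → V'} (hf' : SmoothOn f' U) :
    SmoothOn (fun η => (f η, f' η)) U := by
  intro θ hθ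
  obtain ⟨n, ⟨W, g, hθW, h⟩, W', g', hθW', h'⟩ :=
    ((hf.eventually_exists_represents hθ).and (hf'.eventually_exists_represents hθ)).exists
  exact (h.prodMk h').smoothOn (U := {θ}) (by
    rintro _ rfl
    exact ⟨hθW, hθW'⟩) θ rfl

theorem lineDeriv_const (hf : SmoothOn f U) (v : Jet) :
    SmoothOn (fun η => lineDeriv ℝ f η v) U := by
  intro θ hθ
  obtain ⟨n, W, g, hθW, h⟩ := hf.exists_represents hθ
  exact (h.lineDeriv_const v).smoothOn (U := trunc n ⁻¹' W) (fun _ hη => hη) θ hθW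

theorem hasLineDerivAt (hf : SmoothOn f U) {θ : Jet} (hθ : θ ∈ U) (v : Jet) :
    HasLineDerivAt ℝ f (lineDeriv ℝ f θ v) θ v := by
  obtain ⟨n, W, g, hθW, h⟩ := hf.exists_represents hθ
  exact (h.hasLineDerivAt hθW v).lineDifferentiableAt.hasLineDerivAt

theorem totalX_eq_lineDeriv (hf : SmoothOn f U) {θ : Jet} (hθ : θ ∈ U) :
    totalX f θ = lineDeriv ℝ f θ θ.totalXDir := by
  obtain ⟨n, W, g, hθW, h⟩ := hf.exists_represents hθ
  rw [h.totalX_eq hθW, h.lineDeriv_eq hθW]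

theorem totalT_eq_lineDeriv (hf : SmoothOn f U) (F : Jet → ℝ) {θ : Jet} (hθ : θ ∈ U) :
    totalT F f θ = lineDeriv ℝ f θ (totalTDir F θ) := by
  obtain ⟨n, W, g, hθW, h⟩ := hf.exists_represents hθ
  rw [h.totalT_eq F hθW, h.lineDeriv_eq hθW]

theorem hasLineDerivAt_totalX (hf : SmoothOn f U) {θ : Jet} (hθ : θ ∈ U) :
    HasLineDerivAt ℝ f (totalX f θ) θ θ.totalXDir :=
  hf.totalX_eq_lineDeriv hθ ▸ hf.hasLineDerivAt hθ _

theorem totalX_clm_apply (hf : SmoothOn f U) (L : V →L[ℝ] V') {θ : Jet} (hθ : θ ∈ U) :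
    totalX (fun η => L (f η)) θ = L (totalX f θ) :=
  ((hf.clm_apply L).totalX_eq_lineDeriv hθ).trans
    (L.hasFDerivAt.comp_hasDerivAt (0 : ℝ) (hf.hasLineDerivAt_totalX hθ)).deriv

theorem lineDeriv_totalX (hf : SmoothOn f U) {θ : Jet} (hθ : θ ∈ U) (v : Jet) :
    lineDeriv ℝ (totalX f) θ v =
      totalX (fun η => lineDeriv ℝ f η v) θ + lineDeriv ℝ f θ (shift v) := by
  obtain ⟨n, W, g, hθW, h⟩ := hf.exists_represents hθ
  exact h.lineDeriv_totalX hθW v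

theorem exists_partialU_eq_zero (hf : SmoothOn f U) {θ : Jet} (hθ : θ ∈ U) :
    ∃ O : Set Jet, IsOpen O ∧ θ ∈ O ∧ ∃ n, ∀ η ∈ O, ∀ k ≥ n, partialU k f η = 0 := by
  obtain ⟨n, W, g, hθW, h⟩ := hf.exists_represents hθ
  exact ⟨trunc n ⁻¹' W, h.isOpen_preimage, hθW, n, fun η hη k hk => h.partialU_of_le hη hk⟩

theorem continuousOn (hf : SmoothOn f U) : ContinuousOn f U := by
  intro θ hθ
  obtain ⟨n, W, g, hθW, h⟩ := hf.exists_represents hθ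
  have hW := h.isOpen_preimage.mem_nhds hθW
  exact (((h.differentiableAt hθW).continuousAt.comp (continuous_trunc n).continuousAt).congr
    (Filter.eventuallyEq_of_mem hW fun η hη => (h.eq η hη).symm)).continuousWithinAt

end SmoothOn

end Calculus

section Rigidity

variable {V : Type*} [NormedAddCommGroup V] [NormedSpace ℝ V] {U : Set Jet} {f : Jet → V}
  {G : ℝ × V → V}

open Jet

theorem SmoothOn.totalX_eq_zero (hf : SmoothOn f U) (hU : IsOpen U) (h : ∀ θ ∈ U, f θ = 0)
    {θ : Jet} (hθ : θ ∈ U) : totalX f θ = 0 := by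
  rw [hf.totalX_eq_lineDeriv hθ, lineDeriv_eq_of_eqOn (g := 0) hU h hθ]
  simp [lineDeriv]

theorem lineDeriv_shift_of_totalX_eq (hU : IsOpen U) (hf : SmoothOn f U)
    (hG : ∀ θ ∈ U, DifferentiableAt ℝ G (θ.u 0, f θ))
    (h : ∀ θ ∈ U, totalX f θ = G (θ.u 0, f θ)) {v : Jet} (hv : ∀ θ ∈ U, lineDeriv ℝ f θ v = 0)
    {θ : Jet} (hθ : θ ∈ U) :
    lineDeriv ℝ f θ (shift v) = fderiv ℝ G (θ.u 0, f θ) (v.u 0, 0) := by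
  have hu : HasDerivAt (fun s : ℝ => (θ + s • v).u 0) (v.u 0) 0 := hasLineDerivAt_u 0 θ v
  have hfv : HasDerivAt (fun s : ℝ => f (θ + s • v)) 0 0 := hv θ hθ ▸ hf.hasLineDerivAt hθ v
  have hG' : HasFDerivAt G (fderiv ℝ G (θ.u 0, f θ))
      ((θ + (0 : ℝ) • v).u 0, f (θ + (0 : ℝ) • v)) := by
    simpa only [zero_smul, add_zero] using (hG θ hθ).hasFDerivAt
  calc lineDeriv ℝ f θ (shift v)
      = totalX (fun η => lineDeriv ℝ f η v) θ + lineDeriv ℝ f θ (shift v) := by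
        rw [(hf.lineDeriv_const v).totalX_eq_zero hU hv hθ, zero_add]
    _ = lineDeriv ℝ (totalX f) θ v := (hf.lineDeriv_totalX hθ v).symm
    _ = lineDeriv ℝ (fun η => G (η.u 0, f η)) θ v := lineDeriv_eq_of_eqOn hU h hθ v
    _ = fderiv ℝ G (θ.u 0, f θ) (v.u 0, 0) :=
        (hG'.comp_hasDerivAt (0 : ℝ) (hu.prodMk hfv)).deriv

/-- If `∂f/∂u_j = 0` for all `j > k`, then differentiating `D_x f = G(u, f)` with respect to
`u_{k+1}` gives `∂f/∂u_k = 0`. As `f` locally depends on finitely many coordinates, it depends on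
no `u_k`, and differentiating with respect to `u` gives `∂G/∂u = 0`. -/
theorem fderiv_eq_zero_of_totalX_eq (hU : IsOpen U) (hf : SmoothOn f U)
    (hG : ∀ θ ∈ U, DifferentiableAt ℝ G (θ.u 0, f θ))
    (h : ∀ θ ∈ U, totalX f θ = G (θ.u 0, f θ)) {θ : Jet} (hθ : θ ∈ U) :
    fderiv ℝ G (θ.u 0, f θ) (1, 0) = 0 := by
  obtain ⟨O, hO, hθO, n, hn⟩ := hf.exists_partialU_eq_zero hθ
  have hshift {v : Jet} (hv : ∀ η ∈ U ∩ O, lineDeriv ℝ f η v = 0) {η : Jet} (hη : η ∈ U ∩ O) :=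
    lineDeriv_shift_of_totalX_eq (hU.inter hO) (fun ζ hζ => hf ζ hζ.1) (fun ζ hζ => hG ζ hζ.1)
      (fun ζ hζ => h ζ hζ.1) hv hη
  have hzero : ∀ k, ∀ η ∈ U ∩ O, lineDeriv ℝ f η (uDir k) = 0 := by
    suffices ∀ η ∈ U ∩ O, ∀ k ≥ 0, lineDeriv ℝ f η (uDir k) = 0 from
      fun k η hη => this η hη k k.zero_le
    simp only [partialU_eq_lineDeriv] at hn
    replace hn : ∀ η ∈ U ∩ O, ∀ k ≥ n, lineDeriv ℝ f η (uDir k) = 0 := fun η hη => hn η hη.2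
    induction n with
    | zero => exact hn
    | succ n ih =>
      refine ih fun η hη k hk => ?_
      have hk' := hshift (fun ζ hζ => hn ζ hζ (k + 1) (by omega)) hη
      rwa [shift_uDir_succ, show (uDir (k + 1)).u 0 = 0 by simp [uDir, u],
        Prod.mk_zero_zero, map_zero] at hk'
  have h0 := hshift (hzero 0) ⟨hθ, hθO⟩
  rw [shift_uDir_zero, lineDeriv_zero] at h0
  simpa [uDir, u] using h0.symm

end Rigidity

section LinearSystems

variable {𝕜 E : Type*} [RCLike 𝕜] [NormedAddCommGroup E] [NormedSpace ℝ E] [NormedSpace 𝕜 E]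
  [IsScalarTower ℝ 𝕜 E] {U : Set Jet} {M : ℝ → E →L[𝕜] E} {Q : Jet → E}

open Jet

theorem contDiff_clm_restrictScalars (φ : E →L[𝕜] 𝕜) : ContDiff ℝ ∞ fun e => φ e :=
  (φ.restrictScalars ℝ).contDiff

theorem differentiableAt_clm_apply_prod {p : ℝ × E} (hM : DifferentiableAt ℝ M p.1) :
    DifferentiableAt ℝ (fun q : ℝ × E => M q.1 q.2) p := by
  have hM' : DifferentiableAt ℝ (fun s => (M s).restrictScalars ℝ) p.1 :=
    (ContinuousLinearMap.restrictScalarsL 𝕜 E E ℝ ℝ).differentiableAt.comp p.1 hM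
  exact (hM'.comp p differentiableAt_fst).clm_apply differentiableAt_snd

theorem SmoothOn.normalize (hQ : SmoothOn Q U) {φ : E →L[𝕜] 𝕜} (hφ : ∀ θ ∈ U, φ (Q θ) ≠ 0) :
    SmoothOn (fun θ => (φ (Q θ))⁻¹ • Q θ) U :=
  have hφc := contDiff_clm_restrictScalars φ
  hQ.comp (s := {e | φ e ≠ 0}) (isOpen_ne.preimage φ.continuous)
    ((hφc.contDiffOn.fun_inv fun _ he => he).smul contDiffOn_id) hφ

theorem SmoothOn.totalX_normalize (hQ : SmoothOn Q U) {φ : E →L[𝕜] 𝕜}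
    (hφ : ∀ θ ∈ U, φ (Q θ) ≠ 0) {θ : Jet} (hθ : θ ∈ U) :
    totalX (fun η => (φ (Q η))⁻¹ • Q η) θ =
      (φ (Q θ))⁻¹ • (totalX Q θ - φ (totalX Q θ) • (φ (Q θ))⁻¹ • Q θ) := by
  have hQ' : HasDerivAt (fun s : ℝ => Q (θ + s • θ.totalXDir)) (totalX Q θ) 0 :=
    hQ.hasLineDerivAt_totalX hθ
  have hφQ' := (φ.restrictScalars ℝ).hasFDerivAt.comp_hasDerivAt (0 : ℝ) hQ'
  have hne : φ (Q (θ + (0 : ℝ) • θ.totalXDir)) ≠ 0 := by simpa using hφ θ hθ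
  have h := (hφQ'.fun_inv hne).smul hQ'
  rw [(hQ.normalize hφ).totalX_eq_lineDeriv hθ]
  refine (HasDerivAt.congr_deriv h ?_).deriv
  simp only [ContinuousLinearMap.coe_restrictScalars', Function.comp_apply, zero_smul, add_zero,
    sq, div_eq_mul_inv, mul_inv_rev, neg_mul, neg_smul, smul_smul, smul_sub]
  module

theorem SmoothOn.totalX_normalize_of_totalX_eq (hQ : SmoothOn Q U) {φ : E →L[𝕜] 𝕜}
    (hφ : ∀ θ ∈ U, φ (Q θ) ≠ 0) {θ : Jet} (hθ : θ ∈ U) {L : E →L[𝕜] E} {a : 𝕜}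
    (h : totalX Q θ = L (Q θ) + a • Q θ) :
    totalX (fun η => (φ (Q η))⁻¹ • Q η) θ =
      L ((φ (Q θ))⁻¹ • Q θ) - φ (L ((φ (Q θ))⁻¹ • Q θ)) • (φ (Q θ))⁻¹ • Q θ := by
  have hne := hφ θ hθ
  rw [hQ.totalX_normalize hφ hθ, h]
  simp only [map_add, map_smul, smul_eq_mul]
  match_scalars <;> field_simp
  ring

theorem exists_deriv_apply_eq_smul_of_totalX_eq (hU : IsOpen U) {a : Jet → 𝕜}
    (hQ : SmoothOn Q U) (hM : ∀ θ ∈ U, DifferentiableAt ℝ M (θ.u 0))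
    (h : ∀ θ ∈ U, totalX Q θ = M (θ.u 0) (Q θ) + a θ • Q θ) {θ : Jet} (hθ : θ ∈ U) :
    ∃ c : 𝕜, deriv M (θ.u 0) (Q θ) = c • Q θ := by
  obtain hQθ | hQθ := eq_or_ne (Q θ) 0
  · exact ⟨0, by simp [hQθ]⟩
  obtain ⟨φ, hφ⟩ := SeparatingDual.exists_ne_zero (R := 𝕜) hQθ
  set O : Set Jet := U ∩ Q ⁻¹' {e | φ e ≠ 0}
  have hO : IsOpen O :=
    hQ.continuousOn.isOpen_inter_preimage hU (isOpen_ne.preimage φ.continuous)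
  have hQO : SmoothOn Q O := hQ.mono Set.inter_subset_left
  set ρ : Jet → E := fun η => (φ (Q η))⁻¹ • Q η
  let G : ℝ × E → E := fun q => M q.1 q.2 - φ (M q.1 q.2) • q.2
  have hG {p : ℝ × E} (hp : DifferentiableAt ℝ M p.1) : DifferentiableAt ℝ G p := by
    have hMp := differentiableAt_clm_apply_prod hp
    exact hMp.sub ((((φ.restrictScalars ℝ).differentiableAt).comp p hMp).smul differentiableAt_snd)
  have hρ : ∀ η ∈ O, totalX ρ η = G (η.u 0, ρ η) := fun η hη =>
    hQO.totalX_normalize_of_totalX_eq (fun _ hζ => hζ.2) hη (h η hη.1)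
  have hdir : HasDerivAt (fun s => M s (ρ θ)) (deriv M (θ.u 0) (ρ θ)) (θ.u 0) :=
    ((ContinuousLinearMap.apply 𝕜 E (ρ θ)).restrictScalars ℝ).hasFDerivAt.comp_hasDerivAt _
      (hM θ hθ).hasDerivAt
  have hG' : HasDerivAt (fun s => G (s, ρ θ))
      (deriv M (θ.u 0) (ρ θ) - φ (deriv M (θ.u 0) (ρ θ)) • ρ θ) (θ.u 0) :=
    hdir.sub (((φ.restrictScalars ℝ).hasFDerivAt.comp_hasDerivAt _ hdir).smul_const _)
  have hG0 : deriv M (θ.u 0) (ρ θ) - φ (deriv M (θ.u 0) (ρ θ)) • ρ θ = 0 := by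
    rw [← fderiv_eq_zero_of_totalX_eq hO (hQO.normalize fun _ hζ => hζ.2)
      (fun η hη => hG (hM η hη.1)) hρ ⟨hθ, hφ⟩]
    exact hG'.unique ((hG (hM θ hθ)).hasFDerivAt.comp_hasDerivAt (θ.u 0)
      ((hasDerivAt_id _).prodMk (hasDerivAt_const _ _)))
  refine ⟨φ (deriv M (θ.u 0) (ρ θ)), ?_⟩
  calc deriv M (θ.u 0) (Q θ)
      = φ (Q θ) • deriv M (θ.u 0) (ρ θ) := by rw [← map_smul, smul_inv_smul₀ hφ]
    _ = φ (deriv M (θ.u 0) (ρ θ)) • φ (Q θ) • ρ θ := by rw [smul_comm, ← sub_eq_zero.1 hG0]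
    _ = φ (deriv M (θ.u 0) (ρ θ)) • Q θ := by rw [smul_inv_smul₀ hφ]

end LinearSystems

section Gauge

variable {R : Type*} [NormedRing R] [NormedAlgebra ℝ R] {U : Set Jet}

open Jet

theorem SmoothOn.hasLineDerivAt_totalX_mul {f g : Jet → R} (hf : SmoothOn f U)
    (hg : SmoothOn g U) {θ : Jet} (hθ : θ ∈ U) :
    HasLineDerivAt ℝ (fun η => f η * g η) (totalX f θ * g θ + f θ * totalX g θ) θ
      θ.totalXDir := by
  have h : HasDerivAt _ _ (0 : ℝ) :=
    HasDerivAt.fun_mul (hf.hasLineDerivAt_totalX hθ) (hg.hasLineDerivAt_totalX hθ)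
  simp only [zero_smul, add_zero] at h
  exact h

theorem SmoothOn.totalX_mul_add_mul_totalX_eq_zero {f g : Jet → R} (hU : IsOpen U)
    (hf : SmoothOn f U) (hg : SmoothOn g U) (hfg : ∀ θ ∈ U, f θ * g θ = 0) {θ : Jet}
    (hθ : θ ∈ U) : totalX f θ * g θ + f θ * totalX g θ = 0 := by
  rw [← (hf.hasLineDerivAt_totalX_mul hg hθ).lineDeriv, lineDeriv_eq_of_eqOn (g := 0) hU hfg hθ]
  simp [lineDeriv]

variable [CompleteSpace R]

theorem SmoothOn.inv_mul_mul {S : Jet → Rˣ} (hS : SmoothOn (fun θ => (S θ : R)) U) (N : R) :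
    SmoothOn (fun θ => (↑(S θ)⁻¹ : R) * N * S θ) U := by
  have hP : ContDiffOn ℝ ∞ (fun r : R => Ring.inverse r * N * r) {r | IsUnit r} := by
    rintro _ ⟨r, rfl⟩
    exact (((contDiffAt_ringInverse ℝ r).mul contDiffAt_const).mul contDiffAt_id).contDiffWithinAt
  simpa only [Ring.inverse_unit] using hS.comp Units.isOpen hP fun θ _ => (S θ).isUnit

theorem totalX_inv_mul_mul {k : Type*} [CommSemiring k] [Algebra k R] {S : Jet → Rˣ}
    (hS : SmoothOn (fun θ => (S θ : R)) U) {A A' N : R} {a : k} {θ : Jet} (hθ : θ ∈ U)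
    (hA' : A' = totalX (fun η => (S η : R)) θ * ↑(S θ)⁻¹ + S θ * A * ↑(S θ)⁻¹)
    (hN : N * A' - A' * N = a • N) :
    totalX (fun η => (↑(S η)⁻¹ : R) * N * S η) θ =
      A * (↑(S θ)⁻¹ * N * S θ) - ↑(S θ)⁻¹ * N * S θ * A + a • (↑(S θ)⁻¹ * N * S θ) := by
  have hQ := hS.inv_mul_mul N
  have hSx : totalX (fun η => (S η : R)) θ = A' * S θ - S θ * A := by simp [hA', add_mul]
  have hSQ : (fun η => (S η : R) * (↑(S η)⁻¹ * N * S η)) = fun η => N * (S η : R) := by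
    simp [mul_assoc]
  have hNS : HasLineDerivAt ℝ (fun η => N * (S η : R)) (N * totalX (fun η => (S η : R)) θ) θ
      θ.totalXDir :=
    HasDerivAt.const_mul N (hS.hasLineDerivAt_totalX hθ)
  have hmul : N * (A' * S θ - S θ * A) = (A' * S θ - S θ * A) * (↑(S θ)⁻¹ * N * S θ) +
      S θ * totalX (fun η => (↑(S η)⁻¹ : R) * N * S η) θ := by
    rw [← hSx]
    exact hNS.unique (hSQ ▸ hS.hasLineDerivAt_totalX_mul hQ hθ)
  have hN' : N * A' * S θ = a • (N * S θ) + A' * N * S θ := by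
    rw [← smul_mul_assoc, ← hN, ← add_mul, sub_add_cancel]
  refine (S θ).isUnit.mul_left_cancel ?_
  rw [← sub_eq_iff_eq_add'.2 hmul]
  simp only [mul_sub, ← mul_assoc, hN', sub_mul, Units.mul_inv_cancel_right, mul_add,
    Units.mul_inv, one_mul, Algebra.mul_smul_comm]
  abel

/-- The commutator `(X, Y) ↦ X Y - Y X` of a normed algebra as a continuous bilinear map. -/
def commutatorCLM (𝕜 R : Type*) [RCLike 𝕜] [NormedRing R] [NormedAlgebra 𝕜 R] :
    R →L[𝕜] R →L[𝕜] R :=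
  ContinuousLinearMap.mul 𝕜 R - (ContinuousLinearMap.mul 𝕜 R).flip

variable {𝕜 : Type*} [RCLike 𝕜] [NormedAlgebra 𝕜 R] [IsScalarTower ℝ 𝕜 R]

theorem exists_commutator_deriv_eq_smul {A : ℝ → R} {S : Jet → Rˣ} {A' : Jet → R} {N : R}
    {a : Jet → 𝕜} (hU : IsOpen U) (hS : SmoothOn (fun θ => (S θ : R)) U)
    (hA : ∀ θ ∈ U, DifferentiableAt ℝ A (θ.u 0))
    (hA' : ∀ θ ∈ U, A' θ =
      totalX (fun η => (S η : R)) θ * ↑(S θ)⁻¹ + S θ * A (θ.u 0) * ↑(S θ)⁻¹)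
    (hN : ∀ θ ∈ U, N * A' θ - A' θ * N = a θ • N) {θ : Jet} (hθ : θ ∈ U) :
    ∃ c : 𝕜, deriv A (θ.u 0) * (↑(S θ)⁻¹ * N * S θ) - ↑(S θ)⁻¹ * N * S θ * deriv A (θ.u 0) =
      c • (↑(S θ)⁻¹ * N * S θ) := by
  have hM {η : Jet} (hη : η ∈ U) : HasDerivAt (fun s => commutatorCLM 𝕜 R (A s))
      (commutatorCLM 𝕜 R (deriv A (η.u 0))) (η.u 0) :=
    ((commutatorCLM 𝕜 R).restrictScalars ℝ).hasFDerivAt.comp_hasDerivAt _ (hA η hη).hasDerivAt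
  obtain ⟨c, hc⟩ := exists_deriv_apply_eq_smul_of_totalX_eq hU (hS.inv_mul_mul N)
    (fun η hη => (hM hη).differentiableAt)
    (fun η hη => totalX_inv_mul_mul hS hη (hA' η hη) (hN η hη)) hθ
  rw [(hM hθ).deriv] at hc
  exact ⟨c, hc⟩

end Gauge

section StableLines

variable {𝕜 : Type*} [RCLike 𝕜] {U : Set Jet}

attribute [local instance] Matrix.linftyOpNormedRing Matrix.linftyOpNormedAlgebra

theorem MatrixSmoothOn.smoothOn {M : Jet → Matrix (Fin 2) (Fin 2) 𝕜} (hM : MatrixSmoothOn M U) :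
    SmoothOn M U :=
  (SmoothOn.pi fun i => SmoothOn.pi (hM i)).clm_apply
    (LinearMap.toContinuousLinearMap (Matrix.ofLinearEquiv ℝ).toLinearMap)

theorem SmoothOn.matrix_apply {ι : Type*} [Fintype ι] [DecidableEq ι]
    {M : Jet → Matrix ι ι 𝕜} (hM : SmoothOn M U) (i j : ι) : SmoothOn (fun η => M η i j) U :=
  hM.clm_apply (LinearMap.toContinuousLinearMap (Matrix.entryLinearMap ℝ 𝕜 i j))

theorem SmoothOn.totalX_matrix_apply {ι : Type*} [Fintype ι] [DecidableEq ι]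
    {M : Jet → Matrix ι ι 𝕜} (hM : SmoothOn M U) {θ : Jet} (hθ : θ ∈ U) (i j : ι) :
    totalX (fun η => M η i j) θ = totalX M θ i j :=
  hM.totalX_clm_apply (LinearMap.toContinuousLinearMap (Matrix.entryLinearMap ℝ 𝕜 i j)) hθ

theorem MatrixSmoothOn.matrixTotalX_eq {M : Jet → Matrix (Fin 2) (Fin 2) 𝕜}
    (hM : MatrixSmoothOn M U) {θ : Jet} (hθ : θ ∈ U) : matrixTotalX M θ = totalX M θ :=
  Matrix.ext fun i j => hM.smoothOn.totalX_matrix_apply hθ i j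

/-- The matrix `A` as a function of the single variable `u`. -/
def matrixAOfU (𝕜 : Type*) [RCLike 𝕜] (s : ℝ) : Matrix (Fin 2) (Fin 2) 𝕜 :=
  s⁻¹ • !![1, 0; 0, -1] + !![0, 1; 1, 0]

theorem matrixA_eq (θ : Jet) : matrixA 𝕜 θ = matrixAOfU 𝕜 (θ.u 0) := by
  ext i j
  fin_cases i <;> fin_cases j <;> simp [matrixA, matrixAOfU, RCLike.real_smul_eq_coe_mul]

theorem hasDerivAt_matrixAOfU {s : ℝ} (hs : s ≠ 0) :
    HasDerivAt (matrixAOfU 𝕜) (-(s ^ 2)⁻¹ • !![1, 0; 0, -1]) s :=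
  ((hasDerivAt_inv hs).smul_const _).add_const _

theorem mul_entries_eq_zero_of_commutator_eq_smul {K : Type*} [Field K] [CharZero K]
    {Q : Matrix (Fin 2) (Fin 2) K} {c : K}
    (h : !![1, 0; 0, -1] * Q - Q * !![1, 0; 0, -1] = c • Q) :
    Q 0 0 * Q 0 1 = 0 ∧ Q 0 0 * Q 1 0 = 0 ∧ Q 0 1 * Q 1 0 = 0 := by
  have h00 := congr_fun₂ h 0 0
  have h01 := congr_fun₂ h 0 1
  have h10 := congr_fun₂ h 1 0
  simp only [Matrix.sub_apply, Matrix.mul_apply, Fin.sum_univ_two, Matrix.smul_apply,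
    smul_eq_mul, Matrix.of_apply, Matrix.cons_val_zero, Matrix.cons_val_one] at h00 h01 h10
  refine ⟨?_, ?_, ?_⟩
  · linear_combination Q 0 0 / 2 * h01 - Q 0 1 / 2 * h00
  · linear_combination Q 1 0 / 2 * h00 - Q 0 0 / 2 * h10
  · linear_combination Q 1 0 / 4 * h01 - Q 0 1 / 4 * h10

theorem eq_zero_of_totalX_eq_of_mul_entries_eq_zero (hU : IsOpen U)
    {Q : Jet → Matrix (Fin 2) (Fin 2) 𝕜} (hQ : SmoothOn Q U) (htr : ∀ θ ∈ U, (Q θ).trace = 0)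
    {a : Jet → 𝕜} (h : ∀ θ ∈ U, totalX Q θ = matrixA 𝕜 θ * Q θ - Q θ * matrixA 𝕜 θ + a θ • Q θ)
    (hmul : ∀ θ ∈ U, Q θ 0 0 * Q θ 0 1 = 0 ∧ Q θ 0 0 * Q θ 1 0 = 0 ∧ Q θ 0 1 * Q θ 1 0 = 0)
    {θ : Jet} (hθ : θ ∈ U) : Q θ = 0 := by
  obtain ⟨h0001, h0010, h0110⟩ := hmul θ hθ
  have h11 : Q θ 1 1 = -Q θ 0 0 := by
    linear_combination (Matrix.trace_fin_two (Q θ)).symm.trans (htr θ hθ)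
  have hD (i j : Fin 2) := (hQ.totalX_matrix_apply hθ i j).trans (congr_fun₂ (h θ hθ) i j)
  have hD01 := (hQ.matrix_apply 0 0).totalX_mul_add_mul_totalX_eq_zero hU (hQ.matrix_apply 0 1)
    (fun η hη => (hmul η hη).1) hθ
  have hD10 := (hQ.matrix_apply 0 0).totalX_mul_add_mul_totalX_eq_zero hU (hQ.matrix_apply 1 0)
    (fun η hη => (hmul η hη).2.1) hθ
  simp only [hD, matrixA, Matrix.add_apply, Matrix.sub_apply, Matrix.mul_apply,
    Fin.sum_univ_two, Matrix.smul_apply, smul_eq_mul, Matrix.map_apply, Matrix.of_apply,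
    Matrix.cons_val_zero, Matrix.cons_val_one, RCLike.ofReal_neg, RCLike.ofReal_one, h11]
    at hD01 hD10
  set r : 𝕜 := ((1 / θ.u 0 : ℝ) : 𝕜)
  have h01 : Q θ 0 1 ^ 2 + 2 * Q θ 0 0 ^ 2 = 0 := by
    linear_combination -hD01 + h0110 + 2 * (r + a θ) * h0001
  have h10 : Q θ 1 0 ^ 2 + 2 * Q θ 0 0 ^ 2 = 0 := by
    linear_combination hD10 + h0110 - 2 * (a θ - r) * h0010
  have hp : Q θ 0 0 = 0 :=
    (pow_eq_zero_iff three_ne_zero).1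
      (by linear_combination Q θ 0 0 / 2 * h01 - Q θ 0 1 / 2 * h0001)
  have hq : Q θ 0 1 = 0 := by simpa [hp] using h01
  have hr : Q θ 1 0 = 0 := by simpa [hp] using h10
  rw [Matrix.eta_fin_two (Q θ), h11, hp, hq, hr, neg_zero]
  exact (Matrix.eta_fin_two 0).symm

theorem GaugeEquivOn.eq_zero_of_commutator_eq_smul {F : Jet → ℝ}
    {B A' B' : Jet → Matrix (Fin 2) (Fin 2) 𝕜} (hG : GaugeEquivOn F U (matrixA 𝕜) B A' B')
    (hU : IsOpen U) (hne : U.Nonempty) (hu : ∀ θ ∈ U, θ.u 0 ≠ 0)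
    {N : Matrix (Fin 2) (Fin 2) 𝕜} (htr : N.trace = 0)
    (hN : ∀ θ ∈ U, ∃ a : 𝕜, N * A' θ - A' θ * N = a • N) : N = 0 := by
  obtain ⟨S, hS, hSAB⟩ := hG
  choose! a ha using hN
  set g : Jet → GL (Fin 2) 𝕜 := fun θ => Matrix.SpecialLinearGroup.toGL (S θ)
  have hg : SmoothOn (fun θ => (g θ).val) U := hS.smoothOn
  have hA' : ∀ θ ∈ U, A' θ =
      totalX (fun η => (g η).val) θ * (g θ)⁻¹.val + (g θ).val * matrixA 𝕜 θ * (g θ)⁻¹.val :=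
    fun θ hθ => hS.matrixTotalX_eq hθ ▸ (hSAB θ hθ).1
  have hcomm : ∀ θ ∈ U, ∃ c : 𝕜, !![1, 0; 0, -1] * ((g θ)⁻¹.val * N * (g θ).val) -
      (g θ)⁻¹.val * N * (g θ).val * !![1, 0; 0, -1] = c • ((g θ)⁻¹.val * N * (g θ).val) := by
    intro θ hθ
    simp only [matrixA_eq] at hA'
    obtain ⟨c, hc⟩ := exists_commutator_deriv_eq_smul hU hg
      (fun η hη => (hasDerivAt_matrixAOfU (hu η hη)).differentiableAt) hA' ha hθ
    rw [(hasDerivAt_matrixAOfU (hu θ hθ)).deriv, neg_smul, neg_mul, mul_neg, smul_mul_assoc,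
      mul_smul_comm] at hc
    refine ⟨-(θ.u 0 ^ 2 : ℝ) • c, ?_⟩
    rw [smul_assoc, ← hc, ← neg_sub', ← smul_sub, smul_neg, neg_smul, neg_neg,
      smul_inv_smul₀ (pow_ne_zero 2 (hu θ hθ))]
  obtain ⟨θ, hθ⟩ := hne
  have hQ := eq_zero_of_totalX_eq_of_mul_entries_eq_zero hU (hg.inv_mul_mul N)
    (fun η _ => (Matrix.trace_units_conj' (g η) N).trans htr)
    (fun η hη => totalX_inv_mul_mul hg hη (hA' η hη) (ha η hη))
    (fun η hη => (hcomm η hη).elim fun c hc => mul_entries_eq_zero_of_commutator_eq_smul hc) hθ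
  rwa [Units.mul_left_eq_zero, Units.mul_right_eq_zero] at hQ

end StableLines

section StableElements

open LieAlgebra.SpecialLinear (sl)

theorem lie_mem_span_singleton_of_finrank_le_two {K L : Type*} [Field K] [LieRing L]
    [LieAlgebra K L] [FiniteDimensional K L] (hL : Module.finrank K L ≤ 2) {x y : L}
    (hxy : ⁅x, y⁆ ≠ 0) (z w : L) : ∃ a : K, ⁅z, w⁆ = a • ⁅x, y⁆ := by
  have hli : LinearIndependent K ![x, y] := by
    refine LinearIndependent.pair_iff.2 fun s t hst => ⟨?_, ?_⟩
    · have h : s • ⁅x, y⁆ = 0 := by simpa using congrArg (⁅·, y⁆) hst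
      exact (smul_eq_zero.1 h).resolve_right hxy
    · have h : t • ⁅x, y⁆ = 0 := by simpa using congrArg (⁅x, ·⁆) hst
      exact (smul_eq_zero.1 h).resolve_right hxy
  have hspan : Submodule.span K {x, y} = ⊤ := by
    rw [← Matrix.range_cons_cons_empty x y ![]]
    exact hli.span_eq_top_of_card_eq_finrank'
      (by simpa using (hli.fintype_card_le_finrank.antisymm (by simpa using hL)))
  obtain ⟨a, b, rfl⟩ := Submodule.mem_span_pair.1 (hspan ▸ Submodule.mem_top : z ∈ _)
  obtain ⟨c, d, rfl⟩ := Submodule.mem_span_pair.1 (hspan ▸ Submodule.mem_top : w ∈ _)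
  refine ⟨a * d - b * c, ?_⟩
  simp only [lie_add, add_lie, lie_smul, smul_lie, lie_self, smul_zero, ← lie_skew x y]
  module

theorem exists_ne_zero_forall_lie_eq_smul_of_finrank_le_two {K L : Type*} [Field K] [LieRing L]
    [LieAlgebra K L] [FiniteDimensional K L] [Nontrivial L] (hL : Module.finrank K L ≤ 2) :
    ∃ n : L, n ≠ 0 ∧ ∀ z, ∃ a : K, ⁅n, z⁆ = a • n := by
  by_cases h : ∃ x y : L, ⁅x, y⁆ ≠ 0
  · obtain ⟨x, y, hxy⟩ := h
    exact ⟨⁅x, y⁆, hxy, lie_mem_span_singleton_of_finrank_le_two hL hxy _⟩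
  · push Not at h
    obtain ⟨n, hn⟩ := exists_ne (0 : L)
    exact ⟨n, hn, fun z => ⟨0, by rw [h, zero_smul]⟩⟩

attribute [local instance] LieRing.ofAssociativeRing

theorem finrank_sl (n K : Type*) [Fintype n] [DecidableEq n] [Nonempty n] [Field K] :
    Module.finrank K (sl n K) + 1 = Fintype.card n ^ 2 := by
  obtain ⟨i⟩ := ‹Nonempty n›
  have hsurj : LinearMap.range (Matrix.traceLinearMap n K K) = ⊤ :=
    LinearMap.range_eq_top.2 fun c => ⟨Matrix.single i i c, by simp⟩
  have h := (Matrix.traceLinearMap n K K).finrank_range_add_finrank_ker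
  rw [hsurj, finrank_top, Module.finrank_self, Module.finrank_matrix, Module.finrank_self, mul_one,
    add_comm, ← sq] at h
  exact h

theorem exists_ne_zero_forall_commutator_eq_smul {K : Type*} [Field K]
    {𝔥 : LieSubalgebra K (Matrix (Fin 2) (Fin 2) K)} (h𝔥 : 𝔥 < sl (Fin 2) K) :
    ∃ N : Matrix (Fin 2) (Fin 2) K, N ≠ 0 ∧ N.trace = 0 ∧
      ∀ X ∈ 𝔥, ∃ a : K, N * X - X * N = a • N := by
  rcases subsingleton_or_nontrivial 𝔥 with h | h
  · refine ⟨!![0, 1; 0, 0], fun h01 => one_ne_zero (congr_fun₂ h01 0 1),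
      by simp [Matrix.trace_fin_two], fun X hX => ⟨0, ?_⟩⟩
    obtain rfl : X = 0 := congrArg Subtype.val (Subsingleton.elim (⟨X, hX⟩ : 𝔥) 0)
    rw [mul_zero, zero_mul, sub_zero, zero_smul]
  · have hlt : Module.finrank K 𝔥 < Module.finrank K (sl (Fin 2) K) :=
      Submodule.finrank_lt_finrank_of_lt (s := 𝔥.toSubmodule)
        (t := (sl (Fin 2) K).toSubmodule) h𝔥
    have hsl : Module.finrank K (sl (Fin 2) K) + 1 = 2 ^ 2 := finrank_sl (Fin 2) K
    obtain ⟨N, hN, hstable⟩ :=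
      exists_ne_zero_forall_lie_eq_smul_of_finrank_le_two (K := K) (L := 𝔥) (by lia)
    refine ⟨N, Subtype.coe_ne_coe.2 hN, h𝔥.le N.2, fun X hX => ?_⟩
    obtain ⟨a, ha⟩ := hstable ⟨X, hX⟩
    exact ⟨a, congrArg Subtype.val ha⟩

end StableElements

section Arithmetic

variable {V : Type*} [NormedAddCommGroup V] [NormedSpace ℝ V] {U : Set Jet} {f g : Jet → V}

open Jet

namespace SmoothOn

theorem const (c : V) : SmoothOn (fun _ => c) U :=
  fun _ _ => ⟨0, Set.univ, fun _ => c, isOpen_univ, trivial, contDiffOn_const, fun _ _ => rfl⟩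

theorem neg (hf : SmoothOn f U) : SmoothOn (fun η => -f η) U :=
  hf.comp isOpen_univ contDiff_neg.contDiffOn fun _ _ => trivial

theorem add (hf : SmoothOn f U) (hg : SmoothOn g U) : SmoothOn (fun η => f η + g η) U :=
  (hf.prodMk hg).comp isOpen_univ contDiff_add.contDiffOn fun _ _ => trivial

theorem sub (hf : SmoothOn f U) (hg : SmoothOn g U) : SmoothOn (fun η => f η - g η) U := by
  simpa only [sub_eq_add_neg] using hf.add hg.neg

theorem mul {R : Type*} [NormedRing R] [NormedAlgebra ℝ R] {f g : Jet → R} (hf : SmoothOn f U)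
    (hg : SmoothOn g U) : SmoothOn (fun η => f η * g η) U :=
  (hf.prodMk hg).comp isOpen_univ contDiff_mul.contDiffOn fun _ _ => trivial

theorem div {K : Type*} [NormedField K] [NormedAlgebra ℝ K] {f g : Jet → K} (hf : SmoothOn f U)
    (hg : SmoothOn g U) (hg0 : ∀ θ ∈ U, g θ ≠ 0) : SmoothOn (fun η => f η / g η) U := by
  simpa only [div_eq_mul_inv] using
    hf.mul (hg.comp isOpen_compl_singleton (contDiffOn_inv ℝ) hg0)

theorem totalX_neg (hf : SmoothOn f U) {θ : Jet} (hθ : θ ∈ U) :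
    totalX (fun η => -f η) θ = -totalX f θ :=
  hf.totalX_clm_apply (-ContinuousLinearMap.id ℝ V) hθ

theorem totalT_clm_apply (hf : SmoothOn f U) {V' : Type*} [NormedAddCommGroup V']
    [NormedSpace ℝ V'] (F : Jet → ℝ) (L : V →L[ℝ] V') {θ : Jet} (hθ : θ ∈ U) :
    totalT F (fun η => L (f η)) θ = L (totalT F f θ) := by
  rw [(hf.clm_apply L).totalT_eq_lineDeriv F hθ, hf.totalT_eq_lineDeriv F hθ]
  exact (L.hasFDerivAt.comp_hasDerivAt (0 : ℝ) (hf.hasLineDerivAt hθ _)).deriv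

theorem totalT_neg (hf : SmoothOn f U) (F : Jet → ℝ) {θ : Jet} (hθ : θ ∈ U) :
    totalT F (fun η => -f η) θ = -totalT F f θ :=
  hf.totalT_clm_apply F (-ContinuousLinearMap.id ℝ V) hθ

theorem ofReal (𝕜 : Type*) [RCLike 𝕜] {f : Jet → ℝ} (hf : SmoothOn f U) :
    SmoothOn (fun η => (f η : 𝕜)) U :=
  hf.clm_apply (RCLike.ofRealCLM (K := 𝕜))

end SmoothOn

theorem totalT_const (F : Jet → ℝ) (c : V) (θ : Jet) : totalT F (fun _ => c) θ = 0 := by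
  simp [totalT, partialT, partialU]

theorem smoothOn_u (k : ℕ) : SmoothOn (fun θ => θ.u k) U :=
  fun _ _ => ⟨k + 1, Set.univ, fun y => y.2.2 (Fin.last k), isOpen_univ, trivial,
    by fun_prop, fun _ _ => rfl⟩

end Arithmetic

section ZeroCurvatureEquations

variable {U : Set Jet} {F : Jet → ℝ}

theorem isZCROn_sl₂_of_entries (𝕜 : Type*) [RCLike 𝕜] {a b p q : Jet → ℝ} (ha : SmoothOn a U)
    (hb : SmoothOn b U) (hp : SmoothOn p U) (hq : SmoothOn q U)
    (haT : ∀ θ ∈ U, totalT F a θ = totalX b θ + p θ - q θ)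
    (hpX : ∀ θ ∈ U, totalX p θ = 2 * (a θ * p θ - b θ))
    (hqX : ∀ θ ∈ U, totalX q θ = 2 * (b θ - a θ * q θ)) :
    IsZCROn (sl₂ 𝕜) F U (fun θ => Matrix.map !![a θ, 1; 1, -a θ] fun r : ℝ => (r : 𝕜))
      fun θ => Matrix.map !![b θ, p θ; q θ, -b θ] fun r : ℝ => (r : 𝕜) where
  smooth_A i j := by
    fin_cases i <;> fin_cases j
    exacts [ha.ofReal 𝕜, (SmoothOn.const 1).ofReal 𝕜, (SmoothOn.const 1).ofReal 𝕜,
      ha.neg.ofReal 𝕜]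
  smooth_B i j := by
    fin_cases i <;> fin_cases j
    exacts [hb.ofReal 𝕜, hp.ofReal 𝕜, hq.ofReal 𝕜, hb.neg.ofReal 𝕜]
  mem_A θ _ := (Matrix.trace_fin_two _).trans (by simp)
  mem_B θ _ := (Matrix.trace_fin_two _).trans (by simp)
  zero_curvature θ hθ := by
    have hX {f : Jet → ℝ} (hf : SmoothOn f U) :
        totalX (fun η => (f η : 𝕜)) θ = (totalX f θ : ℝ) :=
      hf.totalX_clm_apply (RCLike.ofRealCLM (K := 𝕜)) hθ
    have hT {f : Jet → ℝ} (hf : SmoothOn f U) :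
        totalT F (fun η => (f η : 𝕜)) θ = (totalT F f θ : ℝ) :=
      hf.totalT_clm_apply F (RCLike.ofRealCLM (K := 𝕜)) hθ
    ext i j
    fin_cases i <;> fin_cases j <;>
      simp only [Fin.zero_eta, Fin.mk_one, matrixTotalT, matrixTotalX, Matrix.add_apply,
        Matrix.sub_apply, Matrix.mul_apply, Fin.sum_univ_two, Matrix.of_apply, Matrix.map_apply,
        Matrix.cons_val_zero, Matrix.cons_val_one, Matrix.cons_val', Matrix.cons_val_fin_one,
        Matrix.zero_apply, totalT_const, hT ha, hT ha.neg, hX hb, hX hb.neg, hX hp, hX hq,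
        ha.totalT_neg F hθ, hb.totalX_neg hθ, haT θ hθ, hpX θ hθ, hqX θ hθ] <;>
      push_cast <;> ring

end ZeroCurvatureEquations

section Coefficients

variable {Ω : Set (ℝ × ℝ)} {β : ℝ → ℝ → ℝ}

theorem derivX_zero (β : ℝ → ℝ → ℝ) (θ : Jet) : derivX 0 β θ = β θ.t θ.x :=
  congr_fun iteratedDeriv_zero θ.x

theorem hasDerivAt_right_of_differentiableAt {V : Type*} [NormedAddCommGroup V] [NormedSpace ℝ V]
    (f : ℝ → ℝ → V) {q : ℝ × ℝ} (hf : DifferentiableAt ℝ (fun q : ℝ × ℝ => f q.1 q.2) q) :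
    HasDerivAt (f q.1) (fderiv ℝ (fun q : ℝ × ℝ => f q.1 q.2) q (0, 1)) q.2 :=
  hf.hasFDerivAt.comp_hasDerivAt (f := fun s => (q.1, s)) q.2
    ((hasDerivAt_const q.2 q.1).prodMk (hasDerivAt_id q.2))

theorem contDiffOn_iteratedDeriv (hΩ : IsOpen Ω)
    (hβ : ContDiffOn ℝ ∞ (fun q : ℝ × ℝ => β q.1 q.2) Ω) (k : ℕ) :
    ContDiffOn ℝ ∞ (fun q : ℝ × ℝ => iteratedDeriv k (β q.1) q.2) Ω := by
  induction k with
  | zero => simpa only [iteratedDeriv_zero] using hβ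
  | succ k ih =>
    refine ((ih.fderiv_of_isOpen hΩ (by simp)).clm_apply
      (contDiffOn_const (c := ((0, 1) : ℝ × ℝ)))).congr fun q hq => ?_
    have hd := (ih.contDiffAt (hΩ.mem_nhds hq)).differentiableAt (by simp)
    rw [iteratedDeriv_succ]
    exact (hasDerivAt_right_of_differentiableAt (fun t => iteratedDeriv k (β t)) hd).deriv

theorem hasDerivAt_iteratedDeriv (hΩ : IsOpen Ω)
    (hβ : ContDiffOn ℝ ∞ (fun q : ℝ × ℝ => β q.1 q.2) Ω) (k : ℕ) {q : ℝ × ℝ} (hq : q ∈ Ω) :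
    HasDerivAt (iteratedDeriv k (β q.1)) (iteratedDeriv (k + 1) (β q.1) q.2) q.2 := by
  have hd := ((contDiffOn_iteratedDeriv hΩ hβ k).contDiffAt (hΩ.mem_nhds hq)).differentiableAt
    (by simp)
  have h := hasDerivAt_right_of_differentiableAt (fun t => iteratedDeriv k (β t)) hd
  rw [iteratedDeriv_succ]
  exact h.differentiableAt.hasDerivAt

theorem smoothOn_derivX (hΩ : IsOpen Ω) (hβ : ContDiffOn ℝ ∞ (fun q : ℝ × ℝ => β q.1 q.2) Ω)
    (k : ℕ) {U : Set Jet} (hU : ∀ θ ∈ U, (θ.t, θ.x) ∈ Ω) : SmoothOn (derivX k β) U :=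
  have hproj : ContDiff ℝ ∞ fun y : ℝ × ℝ × (Fin 0 → ℝ) => (y.1, y.2.1) := by fun_prop
  fun θ hθ => ⟨0, _, _, hΩ.preimage hproj.continuous, hU θ hθ,
    (contDiffOn_iteratedDeriv hΩ hβ k).comp hproj.contDiffOn fun _ hy => hy, fun _ _ => rfl⟩

theorem hasLineDerivAt_derivX (hΩ : IsOpen Ω)
    (hβ : ContDiffOn ℝ ∞ (fun q : ℝ × ℝ => β q.1 q.2) Ω) (k : ℕ) {θ : Jet}
    (hθ : (θ.t, θ.x) ∈ Ω) :
    HasLineDerivAt ℝ (derivX k β) (derivX (k + 1) β θ) θ θ.totalXDir := by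
  have hline (s : ℝ) : derivX k β (θ + s • θ.totalXDir) = iteratedDeriv k (β θ.t) (θ.x + s) := by
    simp [derivX, Jet.t, Jet.x, Jet.totalXDir]
  simp only [HasLineDerivAt, hline]
  refine HasDerivAt.comp_const_add θ.x 0 ?_
  rw [add_zero]
  exact hasDerivAt_iteratedDeriv hΩ hβ k hθ

end Coefficients

section Representation

variable {Ω : Set (ℝ × ℝ)} {β : ℝ → ℝ → ℝ} {U : Set Jet}

open Jet

theorem smoothOn_beta (hΩ : IsOpen Ω) (hβ : ContDiffOn ℝ ∞ (fun q : ℝ × ℝ => β q.1 q.2) Ω)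
    (hU : ∀ θ ∈ U, (θ.t, θ.x) ∈ Ω) : SmoothOn (fun θ => β θ.t θ.x) U := by
  simpa only [funext (derivX_zero β)] using smoothOn_derivX hΩ hβ 0 hU

theorem smoothOn_entryB (hΩ : IsOpen Ω) (hβ : ContDiffOn ℝ ∞ (fun q : ℝ × ℝ => β q.1 q.2) Ω)
    (hU : U ⊆ regularRegion Ω) : SmoothOn (entryB β) U :=
  have hΩU : ∀ θ ∈ U, (θ.t, θ.x) ∈ Ω := fun _ hθ => (hU hθ).1
  have hβX (k : ℕ) : SmoothOn (derivX k β) U := smoothOn_derivX hΩ hβ k hΩU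
  (((hβX 1).neg.mul (smoothOn_u 1)).add ((SmoothOn.const 4).mul
    ((smoothOn_beta hΩ hβ hΩU).div (smoothOn_u 0) fun _ hθ => (hU hθ).2))).sub
      ((hβX 2).mul (smoothOn_u 0))

theorem hasLineDerivAt_beta (hΩ : IsOpen Ω)
    (hβ : ContDiffOn ℝ ∞ (fun q : ℝ × ℝ => β q.1 q.2) Ω) {θ : Jet} (hθ : (θ.t, θ.x) ∈ Ω) :
    HasLineDerivAt ℝ (fun η : Jet => β η.t η.x) (derivX 1 β θ) θ θ.totalXDir := by
  simpa only [funext (derivX_zero β)] using hasLineDerivAt_derivX hΩ hβ 0 hθ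

theorem totalT_one_div_u (F : Jet → ℝ) (hu : ∀ θ ∈ U, θ.u 0 ≠ 0) {θ : Jet} (hθ : θ ∈ U) :
    totalT F (fun η => 1 / η.u 0) θ = -F θ / θ.u 0 ^ 2 := by
  have h : HasDerivAt _ _ (0 : ℝ) := HasDerivAt.fun_inv (hasLineDerivAt_u 0 θ (totalTDir F θ))
    (by simpa only [zero_smul, add_zero] using hu θ hθ)
  rw [((SmoothOn.const (1 : ℝ)).div (smoothOn_u 0) hu).totalT_eq_lineDeriv F hθ]
  simp only [zero_smul, add_zero] at h
  simp only [one_div]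
  exact h.deriv

theorem totalX_entryB (hΩ : IsOpen Ω) (hβ : ContDiffOn ℝ ∞ (fun q : ℝ × ℝ => β q.1 q.2) Ω)
    (hU : U ⊆ regularRegion Ω) {θ : Jet} (hθ : θ ∈ U) :
    totalX (entryB β) θ =
      -derivX 1 β θ * θ.u 2 - 2 * derivX 2 β θ * θ.u 1 - derivX 3 β θ * θ.u 0 +
        4 * ((derivX 1 β θ * θ.u 0 - β θ.t θ.x * θ.u 1) / θ.u 0 ^ 2) := by
  obtain ⟨hΩθ, hu⟩ := hU hθ
  have hβX (k : ℕ) := hasLineDerivAt_derivX hΩ hβ k hΩθ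
  have huX (k : ℕ) := hasLineDerivAt_u k θ θ.totalXDir
  have hdiv : HasDerivAt _ _ (0 : ℝ) := HasDerivAt.fun_div (hasLineDerivAt_beta hΩ hβ hΩθ) (huX 0)
    (by simpa only [zero_smul, add_zero] using hu)
  have h := ((HasDerivAt.fun_mul (HasDerivAt.fun_neg (hβX 1)) (huX 1)).fun_add
    (hdiv.const_mul 4)).fun_sub (HasDerivAt.fun_mul (hβX 2) (huX 0))
  rw [(smoothOn_entryB hΩ hβ hU).totalX_eq_lineDeriv hθ]
  refine h.deriv.trans ?_
  simp only [zero_smul, add_zero, totalXDir, u]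
  ring

theorem smoothOn_two_mul_derivX_mul_u (hΩ : IsOpen Ω)
    (hβ : ContDiffOn ℝ ∞ (fun q : ℝ × ℝ => β q.1 q.2) Ω) (hU : ∀ θ ∈ U, (θ.t, θ.x) ∈ Ω) :
    SmoothOn (fun θ => 2 * derivX 1 β θ * θ.u 0) U :=
  ((SmoothOn.const 2).mul (smoothOn_derivX hΩ hβ 1 hU)).mul (smoothOn_u 0)

theorem hasLineDerivAt_two_mul_derivX_mul_u (hΩ : IsOpen Ω)
    (hβ : ContDiffOn ℝ ∞ (fun q : ℝ × ℝ => β q.1 q.2) Ω) {θ : Jet} (hθ : (θ.t, θ.x) ∈ Ω) :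
    HasLineDerivAt ℝ (fun η : Jet => 2 * derivX 1 β η * η.u 0)
      (2 * derivX 2 β θ * θ.u 0 + 2 * derivX 1 β θ * θ.u 1) θ θ.totalXDir := by
  have h := HasDerivAt.fun_mul (HasDerivAt.const_mul 2 (hasLineDerivAt_derivX hΩ hβ 1 hθ))
    (hasLineDerivAt_u 0 θ θ.totalXDir)
  simp only [zero_smul, add_zero] at h
  exact h

theorem isZCROn_matrixA_matrixB (𝕜 : Type*) [RCLike 𝕜] (hΩ : IsOpen Ω)
    (hβ : ContDiffOn ℝ ∞ (fun q : ℝ × ℝ => β q.1 q.2) Ω) (hU : U ⊆ regularRegion Ω) :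
    IsZCROn (sl₂ 𝕜) (evolutionRHS β) U (matrixA 𝕜) (matrixB 𝕜 β) := by
  have hΩU : ∀ θ ∈ U, (θ.t, θ.x) ∈ Ω := fun θ hθ => (hU hθ).1
  have hu : ∀ θ ∈ U, θ.u 0 ≠ 0 := fun θ hθ => (hU hθ).2
  have hd := (SmoothOn.const (4 : ℝ)).mul (smoothOn_beta hΩ hβ hΩU)
  have hd' := smoothOn_two_mul_derivX_mul_u hΩ hβ hΩU
  have hdX {θ : Jet} (hθ : θ ∈ U) := HasDerivAt.const_mul 4 (hasLineDerivAt_beta hΩ hβ (hU hθ).1)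
  have hdX' {θ : Jet} (hθ : θ ∈ U) := hasLineDerivAt_two_mul_derivX_mul_u hΩ hβ (hU hθ).1
  refine isZCROn_sl₂_of_entries 𝕜 ((SmoothOn.const 1).div (smoothOn_u 0) hu)
    (smoothOn_entryB hΩ hβ hU) (hd.add hd') (hd.sub hd') (fun θ hθ => ?_) (fun θ hθ => ?_)
    fun θ hθ => ?_
  · rw [totalT_one_div_u _ hu hθ, totalX_entryB hΩ hβ hU hθ, evolutionRHS]
    field_simp [hu θ hθ]
    ring
  · rw [(hd.add hd').totalX_eq_lineDeriv hθ]
    refine ((hdX hθ).fun_add (hdX' hθ)).deriv.trans ?_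
    rw [entryB]
    field_simp [hu θ hθ]
    ring
  · rw [(hd.sub hd').totalX_eq_lineDeriv hθ]
    refine ((hdX hθ).fun_sub (hdX' hθ)).deriv.trans ?_
    rw [entryB]
    field_simp [hu θ hθ]
    ring

end Representation

section Irreducibility

variable {𝕜 : Type*} [RCLike 𝕜] {U : Set Jet}

theorem not_reducibleOn_matrixA (hU : IsOpen U) (hne : U.Nonempty) (hu : ∀ θ ∈ U, θ.u 0 ≠ 0)
    (F : Jet → ℝ) (B : Jet → Matrix (Fin 2) (Fin 2) 𝕜) : ¬ ReducibleOn F U (matrixA 𝕜) B := by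
  rintro ⟨𝔥, h𝔥, A', B', hZ, hG⟩
  obtain ⟨N, hN, htr, hstable⟩ := exists_ne_zero_forall_commutator_eq_smul h𝔥
  exact hN (hG.eq_zero_of_commutator_eq_smul hU hne hu htr fun θ hθ => hstable _ (hZ.mem_A θ hθ))

theorem GaugeEquivOn.not_lowerTriangularOn {F : Jet → ℝ}
    {B A' B' : Jet → Matrix (Fin 2) (Fin 2) 𝕜} (hG : GaugeEquivOn F U (matrixA 𝕜) B A' B')
    (hU : IsOpen U) (hne : U.Nonempty) (hu : ∀ θ ∈ U, θ.u 0 ≠ 0) : ¬ LowerTriangularOn U A' B' := by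
  intro hL
  have hstable : ∀ θ ∈ U, ∃ a : 𝕜, !![0, 0; 1, 0] * A' θ - A' θ * !![0, 0; 1, 0] =
      a • !![0, 0; 1, 0] := by
    refine fun θ hθ => ⟨A' θ 0 0 - A' θ 1 1, ?_⟩
    ext i j
    fin_cases i <;> fin_cases j <;>
      simp [Matrix.vecMul, dotProduct, Matrix.mul_apply, (hL θ hθ).1]
  exact one_ne_zero (congr_fun₂ (hG.eq_zero_of_commutator_eq_smul hU hne hu
    (by simp [Matrix.trace_fin_two]) hstable) 1 0)

end Irreducibility

end ZeroCurvature

end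

theorem mainTheorem3_general {𝕜 : Type*} [RCLike 𝕜] (Ω : Set (ℝ × ℝ)) (hΩ : IsOpen Ω)
    (β : ℝ → ℝ → ℝ) (hβ : ContDiffOn ℝ ∞ (fun q : ℝ × ℝ => β q.1 q.2) Ω)
    (U : Set ZeroCurvature.Jet) (hU : IsOpen U) (hne : U.Nonempty)
    (hUΩ : U ⊆ ZeroCurvature.regularRegion Ω) :
    ZeroCurvature.IrreducibleZCROn (ZeroCurvature.evolutionRHS β) U
        (ZeroCurvature.matrixA 𝕜) (ZeroCurvature.matrixB 𝕜 β) ∧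
      ¬ ∃ A' B' : ZeroCurvature.Jet → Matrix (Fin 2) (Fin 2) 𝕜,
          ZeroCurvature.LowerTriangularOn U A' B' ∧
          ZeroCurvature.GaugeEquivOn (ZeroCurvature.evolutionRHS β) U
            (ZeroCurvature.matrixA 𝕜) (ZeroCurvature.matrixB 𝕜 β) A' B' := by
  have hu : ∀ θ ∈ U, θ.u 0 ≠ 0 := fun θ hθ => (hUΩ hθ).2
  exact ⟨⟨ZeroCurvature.isZCROn_matrixA_matrixB 𝕜 hΩ hβ hUΩ,
      ZeroCurvature.not_reducibleOn_matrixA hU hne hu _ _⟩,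
    fun ⟨_, _, hL, hG⟩ => hG.not_lowerTriangularOn hU hne hu hL⟩

theorem mainTheorem3 {𝕜 : Type*} [RCLike 𝕜] (Ω : Set (ℝ × ℝ)) (hΩ : IsOpen Ω)
    (β : ℝ → ℝ → ℝ) (hβ : ContDiffOn ℝ ∞ (fun q : ℝ × ℝ => β q.1 q.2) Ω)
    (hβx : ∀ q ∈ Ω, deriv (β q.1) q.2 ≠ 0)
    (U : Set ZeroCurvature.Jet) (hU : IsOpen U) (hne : U.Nonempty)
    (hUΩ : U ⊆ ZeroCurvature.regularRegion Ω) :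
    ZeroCurvature.IrreducibleZCROn (ZeroCurvature.evolutionRHS β) U
        (ZeroCurvature.matrixA 𝕜) (ZeroCurvature.matrixB 𝕜 β) ∧
      ¬ ∃ A' B' : ZeroCurvature.Jet → Matrix (Fin 2) (Fin 2) 𝕜,
          ZeroCurvature.LowerTriangularOn U A' B' ∧
          ZeroCurvature.GaugeEquivOn (ZeroCurvature.evolutionRHS β) U
            (ZeroCurvature.matrixA 𝕜) (ZeroCurvature.matrixB 𝕜 β) A' B' := by
  exact mainTheorem3_general Ω hΩ β hβ U hU hne hUΩ
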